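/- Let $q\in L^1_{\mathrm{loc}}(\mathbb{R})$ be complex-valued, and let $$M(q)=i\begin{pmatrix} \frac{d}{dx} & -q\\ -\overline{q} & -\frac{d}{dx}\end{pmatrix}.$$ In the Hilbert space $L^2(\mathbb{R})^2=L^2(\mathbb{R};\mathbb{C}^2)$ define $D_{\max}(q)F=M(q)F$ on $$\mathrm{dom}(D_{\max}(q))=\{G\in L^2(\mathbb{R})^2 \mid G\in AC_{\mathrm{loc}}(\mathbb{R})^2,\ M(q)G\in L^2(\mathbb{R})^2\},$$ and let $D_{\min}(q)$ be the restriction of $D_{\max}(q)$ to those $G\in\mathrm{dom}(D_{\max}(q))$ that have compact support. Let $\mathcal{J}$ be the conjugation (antilinear involution with $(\mathcal{J}u,v)=(\mathcal{J}v,u)$) in $L^2(\mathbb{R})^2$ given by $\mathcal{J}(f_1,f_2)^\top=(\overline{f_2},\overline{f_1})^\top$, i.e., $\mathcal J=\sigma_1\mathcal C$ with $\sigma_1=\begin{pmatrix}0&1\\1&0\end{pmatrix}$ and $\mathcal C$ complex conjugation. A densely defined operator $S$ is called $\mathcal{J}$-self-adjoint if $S=\mathcal{J}S^*\mathcal{J}$,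 and a densely defined closable operator is called essentially $\mathcal{J}$-self-adjoint if its closure is $\mathcal{J}$-self-adjoint. Then $D_{\min}(q)$ is essentially $\mathcal{J}$-self-adjoint (in particular densely defined and closable), that is, $$\overline{D_{\min}(q)}=\mathcal{J}D_{\min}(q)^*\mathcal{J}.$$ Moreover, $$\overline{D_{\min}(q)}=D_{\max}(q),$$ and hence $D_{\max}(q)$ is $\mathcal{J}$-self-adjoint. -/

import Mathlib

open MeasureTheory Filter
open scoped ComplexConjugate Topology ENNReal

noncomputable section

namespace NLSDirac

/-! ### Conjugations and `J`-self-adjointness in a complex Hilbert space -/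

section Abstract

variable {H : Type*} [NormedAddCommGroup H] [InnerProductSpace ℂ H]

/-- A conjugation in a complex Hilbert space: an antilinear involution `J` with
`(J u, v) = (J v, u)` for all `u, v`, where `(u, v) = inner ℂ v u` is the scalar product which is
linear in the first place. -/
structure Conjugation (H : Type*) [NormedAddCommGroup H] [InnerProductSpace ℂ H] where
  /-- The underlying antilinear map. -/
  map : H →ₗ⋆[ℂ] H
  involutive : ∀ u, map (map u) = u
  inner_map : ∀ u v, inner ℂ v (map u) = inner ℂ u (map v)

/-- The operator `J S J`, with its natural domain `{u | J u ∈ dom S}`. -/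
def Conjugation.sandwich (J : Conjugation H) (S : H →ₗ.[ℂ] H) : H →ₗ.[ℂ] H where
  domain := S.domain.comap J.map
  toFun :=
    { toFun := fun u => J.map (S ⟨J.map u, u.2⟩)
      map_add' := fun u v => by
        rw [← map_add, ← LinearPMap.map_add]
        congr 2
        ext
        simp
      map_smul' := fun c u => by
        have h : (⟨J.map ((c • u : S.domain.comap J.map) : H), (c • u).2⟩ : S.domain)
            = conj c • ⟨J.map u, u.2⟩ := by
          ext
          simp
        rw [h, LinearPMap.map_smul]
        simp }

variable [CompleteSpace H]

/-- A densely defined operator `S` is `J`-self-adjoint if `S = J S* J`. -/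
def IsJSelfAdjoint (J : Conjugation H) (S : H →ₗ.[ℂ] H) : Prop :=
  Dense (S.domain : Set H) ∧ S = J.sandwich S.adjoint

/-- A densely defined, closable operator is essentially `J`-self-adjoint if its closure is
`J`-self-adjoint. -/
def IsEssentiallyJSelfAdjoint (J : Conjugation H) (T : H →ₗ.[ℂ] H) : Prop :=
  Dense (T.domain : Set H) ∧ T.IsClosable ∧ IsJSelfAdjoint J T.closure

end Abstract

/-! ### The space `L²(ℝ)²` and the conjugation `J = σ₁ C` -/

/-- `ℂ²` with its Euclidean norm. -/
abbrev C2 : Type := EuclideanSpace ℂ (Fin 2)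

/-- The Hilbert space `L²(ℝ)² = L²(ℝ; ℂ²)`. -/
abbrev L2 : Type := Lp C2 2 (volume : Measure ℝ)

/-- The map `(a, b) ↦ (conj b, conj a)` of `ℂ²`. -/
def sigmaConj : C2 →L⋆[ℂ] C2 where
  toFun v := !₂[conj (v 1), conj (v 0)]
  map_add' u v := by
    ext i
    fin_cases i <;> simp
  map_smul' c v := by
    ext i
    fin_cases i <;> simp
  cont := by
    refine (PiLp.continuous_toLp 2 _).comp (continuous_pi fun i => ?_)
    fin_cases i
    · exact Complex.continuous_conj.comp (PiLp.continuous_apply 2 _ 1)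
    · exact Complex.continuous_conj.comp (PiLp.continuous_apply 2 _ 0)

/-- The conjugation `(J F)(x) = (conj (F₂ x), conj (F₁ x))` of `L²(ℝ)²`. -/
def J : Conjugation L2 where
  map := (sigmaConj.compLpL 2 volume : L2 →L⋆[ℂ] L2).toLinearMap
  involutive u := by
    apply Lp.ext
    filter_upwards [sigmaConj.coeFn_compLpL (p := 2) (μ := volume) u,
      sigmaConj.coeFn_compLpL (p := 2) (μ := volume) (sigmaConj.compLpL 2 volume u)]
      with x h1 h2
    refine h2.trans ?_
    rw [h1]
    ext i
    fin_cases i <;> simp [sigmaConj]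
  inner_map u v := by
    rw [L2.inner_def, L2.inner_def]
    apply integral_congr_ae
    filter_upwards [sigmaConj.coeFn_compLpL (p := 2) (μ := volume) u,
      sigmaConj.coeFn_compLpL (p := 2) (μ := volume) v] with x h1 h2
    change inner ℂ (v x) ((sigmaConj.compLpL 2 volume u : L2) x)
      = inner ℂ (u x) ((sigmaConj.compLpL 2 volume v : L2) x)
    rw [h1, h2]
    simp [sigmaConj, PiLp.inner_apply, Fin.sum_univ_two]
    ring

/-! ### Local absolute continuity and the differential expression `M(q)` -/

/-- `g ∈ AC_loc(ℝ)²`: absolute continuity on every compact interval. -/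
def ACLoc (g : ℝ → C2) : Prop :=
  ∀ a b : ℝ, AbsolutelyContinuousOnInterval g a b

/-- The differential expression `M(q) = i ((d/dx, -q), (-conj q, -d/dx))`, acting on functions
that are differentiable almost everywhere. -/
def M (q : ℝ → ℂ) (g : ℝ → C2) : ℝ → C2 := fun x =>
  !₂[Complex.I * (deriv (fun t => g t 0) x - q x * g x 1),
     Complex.I * (-conj (q x) * g x 0 - deriv (fun t => g t 1) x)]

theorem ACLoc.continuous {g : ℝ → C2} (hg : ACLoc g) : Continuous g := by
  rw [continuous_iff_continuousAt]
  intro x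
  refine (hg (x - 1) (x + 1)).continuousOn.continuousAt ?_
  rw [Set.uIcc_of_le (by linarith)]
  exact Icc_mem_nhds (by linarith) (by linarith)

theorem ACLoc.ae_differentiableAt {g : ℝ → C2} (hg : ACLoc g) :
    ∀ᵐ x : ℝ, DifferentiableAt ℝ g x := by
  have h : ∀ᵐ x : ℝ, ∀ n : ℕ, x ∈ Set.uIcc (-(n : ℝ)) n → DifferentiableAt ℝ g x :=
    ae_all_iff.2 fun n => (hg _ _).boundedVariationOn.ae_differentiableAt_of_mem_uIcc
  filter_upwards [h] with x hx
  obtain ⟨n, hn⟩ := exists_nat_ge |x|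
  refine hx n ?_
  rw [Set.uIcc_of_le (by linarith [abs_nonneg x])]
  exact abs_le.1 hn

theorem ACLoc.zero : ACLoc 0 := fun a b => by
  rw [absolutelyContinuousOnInterval_iff]
  exact fun ε hε => ⟨1, one_pos, fun E _ _ => by simpa using hε⟩

theorem ACLoc.add {g h : ℝ → C2} (hg : ACLoc g) (hh : ACLoc h) : ACLoc (g + h) :=
  fun a b => (hg a b).add (hh a b)

theorem ACLoc.smul {g : ℝ → C2} (c : ℂ) (hg : ACLoc g) : ACLoc (c • g) :=
  fun a b => (hg a b).const_smul c

theorem differentiableAt_coord {g : ℝ → C2} {x : ℝ} (h : DifferentiableAt ℝ g x) (i : Fin 2) :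
    DifferentiableAt ℝ (fun t => g t i) x :=
  ((EuclideanSpace.proj i : C2 →L[ℂ] ℂ).restrictScalars ℝ).differentiableAt.comp x h

theorem M_zero (q : ℝ → ℂ) : M q 0 = 0 := by
  ext x i
  fin_cases i <;> simp [M]

theorem M_add (q : ℝ → ℂ) {g h : ℝ → C2} (hg : ACLoc g) (hh : ACLoc h) :
    M q (g + h) =ᵐ[volume] M q g + M q h := by
  filter_upwards [hg.ae_differentiableAt, hh.ae_differentiableAt] with x h1 h2
  have e : ∀ i : Fin 2, deriv (fun t => (g + h) t i) x
      = deriv (fun t => g t i) x + deriv (fun t => h t i) x := fun i =>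
    deriv_fun_add (differentiableAt_coord h1 i) (differentiableAt_coord h2 i)
  ext i
  fin_cases i
  · rw [Pi.add_apply]
    simp only [M, e]
    simp
    ring
  · rw [Pi.add_apply]
    simp only [M, e]
    simp
    ring

theorem M_smul (q : ℝ → ℂ) {g : ℝ → C2} (c : ℂ) (hg : ACLoc g) :
    M q (c • g) =ᵐ[volume] c • M q g := by
  filter_upwards [hg.ae_differentiableAt] with x h1
  have e : ∀ i : Fin 2, deriv (fun t => (c • g) t i) x = c * deriv (fun t => g t i) x := fun i =>
    deriv_const_mul c (differentiableAt_coord h1 i)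
  ext i
  fin_cases i
  · rw [Pi.smul_apply]
    simp only [M, e]
    simp
    ring
  · rw [Pi.smul_apply]
    simp only [M, e]
    simp
    ring

/-! ### The maximal and minimal operators -/

/-- `g` is the locally absolutely continuous representative of `G ∈ L²(ℝ)²`, and
`M(q) g ∈ L²(ℝ)²`. -/
structure IsMaxRep (q : ℝ → ℂ) (G : L2) (g : ℝ → C2) : Prop where
  aeEq : G =ᵐ[volume] g
  acLoc : ACLoc g
  memLp : MemLp (M q g) 2 volume

theorem IsMaxRep.unique {q : ℝ → ℂ} {G : L2} {g h : ℝ → C2} (hg : IsMaxRep q G g)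
    (hh : IsMaxRep q G h) : g = h :=
  (Continuous.ae_eq_iff_eq volume hg.acLoc.continuous hh.acLoc.continuous).1
    (hg.aeEq.symm.trans hh.aeEq)

theorem IsMaxRep.zero (q : ℝ → ℂ) : IsMaxRep q 0 0 where
  aeEq := Lp.coeFn_zero _ _ _
  acLoc := ACLoc.zero
  memLp := by
    rw [M_zero]
    exact MemLp.zero

theorem IsMaxRep.add {q : ℝ → ℂ} {G K : L2} {g k : ℝ → C2} (hg : IsMaxRep q G g)
    (hk : IsMaxRep q K k) : IsMaxRep q (G + K) (g + k) where
  aeEq := (Lp.coeFn_add G K).trans (hg.aeEq.add hk.aeEq)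
  acLoc := hg.acLoc.add hk.acLoc
  memLp := (memLp_congr_ae (M_add q hg.acLoc hk.acLoc)).2 (hg.memLp.add hk.memLp)

theorem IsMaxRep.smul {q : ℝ → ℂ} {G : L2} {g : ℝ → C2} (c : ℂ) (hg : IsMaxRep q G g) :
    IsMaxRep q (c • G) (c • g) where
  aeEq := (Lp.coeFn_smul c G).trans (hg.aeEq.const_smul c)
  acLoc := hg.acLoc.smul c
  memLp := (memLp_congr_ae (M_smul q c hg.acLoc)).2 (hg.memLp.const_smul c)

/-- `dom D_max(q) = {G ∈ L²(ℝ)² | G ∈ AC_loc(ℝ)², M(q) G ∈ L²(ℝ)²}`. -/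
def maxDomain (q : ℝ → ℂ) : Submodule ℂ L2 where
  carrier := {G | ∃ g, IsMaxRep q G g}
  zero_mem' := ⟨0, IsMaxRep.zero q⟩
  add_mem' := fun ⟨g, hg⟩ ⟨k, hk⟩ => ⟨g + k, hg.add hk⟩
  smul_mem' := fun c _ ⟨g, hg⟩ => ⟨c • g, hg.smul c⟩

/-- The maximal operator `D_max(q) G = M(q) G`. -/
def DMax (q : ℝ → ℂ) : L2 →ₗ.[ℂ] L2 where
  domain := maxDomain q
  toFun :=
    { toFun := fun G => G.2.choose_spec.memLp.toLp
      map_add' := fun G K => by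
        have e := IsMaxRep.unique (G + K).2.choose_spec (G.2.choose_spec.add K.2.choose_spec)
        rw [← MemLp.toLp_add, MemLp.toLp_eq_toLp_iff, e]
        exact M_add q G.2.choose_spec.acLoc K.2.choose_spec.acLoc
      map_smul' := fun c G => by
        have e := IsMaxRep.unique (c • G).2.choose_spec (G.2.choose_spec.smul c)
        rw [RingHom.id_apply, ← MemLp.toLp_const_smul, MemLp.toLp_eq_toLp_iff, e]
        exact M_smul q c G.2.choose_spec.acLoc }

/-- The defining property of `D_max(q)`: its value at `G` is `M(q)` applied to the locally
absolutely continuous representative of `G`. -/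
theorem DMax_apply {q : ℝ → ℂ} (G : (DMax q).domain) {g : ℝ → C2} (hg : IsMaxRep q G g) :
    (DMax q G : ℝ → C2) =ᵐ[volume] M q g := by
  have e := IsMaxRep.unique G.2.choose_spec hg
  have h : (DMax q G : ℝ → C2) =ᵐ[volume] M q G.2.choose := MemLp.coeFn_toLp G.2.choose_spec.memLp
  rwa [e] at h

/-- The elements of `L²(ℝ)²` with compact (essential) support. -/
def compactSupp : Submodule ℂ L2 where
  carrier := {G | ∃ K : Set ℝ, IsCompact K ∧ ∀ᵐ x : ℝ, x ∉ K → G x = 0}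
  zero_mem' := ⟨∅, isCompact_empty, by
    filter_upwards [Lp.coeFn_zero C2 2 (volume : Measure ℝ)] with x hx _ using hx⟩
  add_mem' := by
    rintro G G' ⟨K, hK, h⟩ ⟨K', hK', h'⟩
    refine ⟨K ∪ K', hK.union hK', ?_⟩
    filter_upwards [h, h', Lp.coeFn_add G G'] with x h1 h2 h3 hx
    rw [Set.mem_union, not_or] at hx
    rw [h3, Pi.add_apply, h1 hx.1, h2 hx.2, add_zero]
  smul_mem' := by
    rintro c G ⟨K, hK, h⟩
    refine ⟨K, hK, ?_⟩
    filter_upwards [h, Lp.coeFn_smul c G] with x h1 h2 hx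
    rw [h2, Pi.smul_apply, h1 hx, smul_zero]

/-- The minimal operator `D_min(q)`: the restriction of `D_max(q)` to the elements of its domain
with compact support. -/
def DMin (q : ℝ → ℂ) : L2 →ₗ.[ℂ] L2 := (DMax q).domRestrict compactSupp

end NLSDirac

end

/-!
The matrix `-i ((0, q), (conj q, 0))` in `M(q)` is skew-Hermitian, so the formal adjoint of `M(q)` is
`M(-q)`, and `J M(q) J = M(-q)`. The theorem therefore amounts to
`D_min(q)* = D_max(-q)` and `closure D_min(q) = D_max(q)`, the latter expressing that no boundary
conditions are needed at `±∞` (the limit point case). Two facts carry the proof.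

* Green's formula holds on the maximal domains without boundary terms
  (`inner_eq_of_mem_graph_DMax`): for `F ∈ dom D_max(q)` and `G ∈ dom D_max(-q)` the boundary form
  `f₁ conj g₁ - f₂ conj g₂` is integrable on `ℝ` and has an integrable derivative, hence vanishes
  at `±∞`.
* `D_min(q)* ⊆ D_max(-q)` (`mem_graph_DMax_neg_of_adjoint`). As `q` is only locally integrable,
  smooth functions need not be in the domain of `D_min(q)`, so the test functions are `φ v` with a
  scalar `φ ∈ C¹_c` and a solution `v` of `M(q) v = 0`, for which `M(q) (φ v) = i φ' σ₃ v`. The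
  system `M(q) v = 0` is solved globally by a contraction argument in a weighted space
  (`exists_isLocPrimitive_linear`), and its coefficient matrix is skew-Hermitian, so that one
  solution of norm one and its image under `(v₁, v₂) ↦ (-conj v₂, conj v₁)` form a unitary
  fundamental matrix. Testing with its columns gives scalar weak derivatives, which the lemma of
  du Bois-Reymond integrates; for `K = D_min(q)* Y`, the fundamental matrix turns the result into
  `M(-q) Y = K`. The case `Y = 0` also shows that `dom D_min(q)` is dense.

Together they give `D_min(q)* = D_max(-q) = D_max(q)*`. So `D_max(q)` is closed, being an adjoint,
and `D_max(q) ⊆ D_max(-q)* = D_min(q)**`, which is the closure of `D_min(q)`.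

Local absolute continuity is handled in integrated form, by the predicate `IsLocPrimitive`.
-/

namespace NLSDirac

/-! ### Primitives of locally integrable functions -/

theorem _root_.MeasureTheory.LocallyIntegrable.intervalIntegrable_real
    {E : Type*} [NormedAddCommGroup E] {f : ℝ → E}
    (hf : LocallyIntegrable f volume) (a b : ℝ) : IntervalIntegrable f volume a b :=
  intervalIntegrable_iff.2
    ((hf.integrableOn_isCompact isCompact_uIcc).mono_set Set.uIoc_subset_uIcc)

section Primitive

variable {E F : Type*} [NormedAddCommGroup E] [NormedSpace ℝ E]
  [NormedAddCommGroup F] [NormedSpace ℝ F]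

/-- `f` is locally absolutely continuous on `ℝ` with derivative `f'` in the integrated sense: `f'`
is locally integrable, and its integrals are the increments of `f`. Only the almost everywhere class
of `f'` matters, while `f` is pinned down pointwise up to a constant. -/
structure IsLocPrimitive (f f' : ℝ → E) : Prop where
  locallyIntegrable : LocallyIntegrable f' volume
  integral_eq : ∀ x y : ℝ, ∫ t in x..y, f' t = f y - f x

/-- A function whose increments are dominated by those of an absolutely continuous function is
absolutely continuous. -/
theorem _root_.AbsolutelyContinuousOnInterval.of_dist_le {X Y : Type*} [PseudoMetricSpace X]
    [PseudoMetricSpace Y] {f : ℝ → X} {g : ℝ → Y} {a b : ℝ}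
    (hg : AbsolutelyContinuousOnInterval g a b)
    (h : ∀ x ∈ Set.uIcc a b, ∀ y ∈ Set.uIcc a b, dist (f x) (f y) ≤ dist (g x) (g y)) :
    AbsolutelyContinuousOnInterval f a b := by
  rw [absolutelyContinuousOnInterval_iff] at hg ⊢
  intro ε hε
  obtain ⟨δ, hδ, H⟩ := hg ε hε
  refine ⟨δ, hδ, fun I hI hlt => lt_of_le_of_lt (Finset.sum_le_sum fun i hi => ?_) (H I hI hlt)⟩
  exact h _ (hI.1 i hi).1 _ (hI.1 i hi).2

/-- A `C¹` function of an absolutely continuous real function is absolutely continuous. -/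
theorem _root_.AbsolutelyContinuousOnInterval.contDiff_comp {φ f : ℝ → ℝ} {a b : ℝ}
    (hφ : ContDiff ℝ 1 φ) (hf : AbsolutelyContinuousOnInterval f a b) :
    AbsolutelyContinuousOnInterval (fun x => φ (f x)) a b := by
  obtain ⟨C, hC⟩ := hf.exists_bound
  obtain ⟨K, hK⟩ := (hφ.contDiffOn (s := Set.Icc (-C) C)).exists_lipschitzOnWith one_ne_zero
    (convex_Icc _ _) isCompact_Icc
  refine (hf.const_mul (K : ℝ)).of_dist_le fun x hx y hy => ?_
  refine (hK.dist_le_mul _ (abs_le.1 (hC x hx)) _ (abs_le.1 (hC y hy))).trans_eq ?_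
  rw [Real.dist_eq, Real.dist_eq, ← mul_sub, abs_mul, NNReal.abs_eq]

namespace IsLocPrimitive

variable {f f' g g' : ℝ → E}

theorem of_integral {u : ℝ → E} (hu : LocallyIntegrable u volume) (c : E) (a : ℝ) :
    IsLocPrimitive (fun x => c + ∫ t in a..x, u t) u where
  locallyIntegrable := hu
  integral_eq x y := by
    rw [add_sub_add_left_eq_sub, intervalIntegral.integral_interval_sub_left] <;>
      exact hu.intervalIntegrable_real _ _

theorem eq_add_integral (h : IsLocPrimitive f f') (x : ℝ) : f x = f 0 + ∫ t in (0 : ℝ)..x, f' t := by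
  rw [h.integral_eq]
  abel

theorem congr (h : IsLocPrimitive f f') {u : ℝ → E} (hu : f' =ᵐ[volume] u) :
    IsLocPrimitive f u where
  locallyIntegrable := h.locallyIntegrable.congr hu
  integral_eq x y := by
    rw [← h.integral_eq x y]
    exact intervalIntegral.integral_congr_ae (hu.mono fun x hx _ => hx.symm)

theorem absolutelyContinuousOnInterval (h : IsLocPrimitive f f') (a b : ℝ) :
    AbsolutelyContinuousOnInterval f a b := by
  have hn : LocallyIntegrable (fun t => ‖f' t‖) volume := by
    have := h.locallyIntegrable
    rw [← locallyIntegrableOn_univ] at this ⊢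
    exact this.norm
  refine ((hn.intervalIntegrable_real a b).absolutelyContinuousOnInterval_intervalIntegral
    (c := a) Set.left_mem_uIcc).of_dist_le fun x _ y _ => ?_
  rw [dist_comm, dist_eq_norm, ← h.integral_eq, dist_comm, Real.dist_eq,
    intervalIntegral.integral_interval_sub_left (hn.intervalIntegrable_real _ _)
      (hn.intervalIntegrable_real _ _)]
  exact intervalIntegral.norm_integral_le_abs_integral_norm

theorem continuous (h : IsLocPrimitive f f') : Continuous f := by
  rw [continuous_iff_continuousAt]
  intro x
  refine (h.absolutelyContinuousOnInterval (x - 1) (x + 1)).continuousOn.continuousAt ?_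
  rw [Set.uIcc_of_le (by linarith)]
  exact Icc_mem_nhds (by linarith) (by linarith)

/-- The Lebesgue differentiation theorem. -/
theorem ae_hasDerivAt [CompleteSpace E] (h : IsLocPrimitive f f') :
    ∀ᵐ x : ℝ, HasDerivAt f (f' x) x := by
  filter_upwards [LocallyIntegrable.ae_hasDerivAt_integral h.locallyIntegrable] with x hx
  have e : f = fun x => f 0 + ∫ t in (0 : ℝ)..x, f' t := funext h.eq_add_integral
  rw [e]
  exact (hx 0).const_add _

/-- The fundamental theorem of calculus for locally absolutely continuous functions. -/
theorem of_ae_hasDerivAt [CompleteSpace E] (hac : ∀ a b, AbsolutelyContinuousOnInterval f a b)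
    (hd : ∀ᵐ x : ℝ, HasDerivAt f (f' x) x) (hi : LocallyIntegrable f' volume) :
    IsLocPrimitive f f' where
  locallyIntegrable := hi
  integral_eq x y := by
    have hp := of_integral hi 0 x
    have hd0 : ∀ᵐ t : ℝ, t ∈ Set.uIcc x y →
        HasDerivAt (f - fun z => 0 + ∫ t in x..z, f' t) 0 t := by
      filter_upwards [hd, hp.ae_hasDerivAt] with t h1 h2 _
      simpa using h1.sub h2
    obtain ⟨C, hC⟩ := ((hac x y).sub
      (hp.absolutelyContinuousOnInterval x y)).const_of_ae_hasDerivAt_zero hd0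
    have h1 := hC x Set.left_mem_uIcc
    have h2 := hC y Set.right_mem_uIcc
    simp only [Pi.sub_apply, intervalIntegral.integral_same, zero_add, sub_zero] at h1 h2
    rw [h1, ← h2]
    abel

theorem add (hf : IsLocPrimitive f f') (hg : IsLocPrimitive g g') :
    IsLocPrimitive (fun x => f x + g x) (fun x => f' x + g' x) where
  locallyIntegrable := hf.locallyIntegrable.add hg.locallyIntegrable
  integral_eq x y := by
    rw [intervalIntegral.integral_add (hf.locallyIntegrable.intervalIntegrable_real _ _)
      (hg.locallyIntegrable.intervalIntegrable_real _ _), hf.integral_eq, hg.integral_eq]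
    abel

theorem clm_comp [CompleteSpace E] [CompleteSpace F] (L : E →L[ℝ] F) (hf : IsLocPrimitive f f') :
    IsLocPrimitive (fun x => L (f x)) (fun x => L (f' x)) where
  locallyIntegrable := by
    rw [← locallyIntegrableOn_univ]
    exact L.locallyIntegrableOn_comp (hf.locallyIntegrable.locallyIntegrableOn _)
  integral_eq x y := by
    rw [L.intervalIntegral_comp_comm (hf.locallyIntegrable.intervalIntegrable_real _ _),
      hf.integral_eq, map_sub]

theorem of_contDiff [CompleteSpace E] (hf : ContDiff ℝ 1 f) : IsLocPrimitive f (deriv f) :=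
  of_ae_hasDerivAt (fun _ _ => hf.contDiffOn.absolutelyContinuousOnInterval)
    (.of_forall fun x => (hf.differentiable one_ne_zero x).hasDerivAt)
    (hf.continuous_deriv le_rfl).locallyIntegrable

theorem star {f f' : ℝ → ℂ} (hf : IsLocPrimitive f f') :
    IsLocPrimitive (fun x => conj (f x)) (fun x => conj (f' x)) :=
  hf.clm_comp (Complex.conjCLE : ℂ →L[ℝ] ℂ)

theorem const_mul {f f' : ℝ → ℂ} (c : ℂ) (hf : IsLocPrimitive f f') :
    IsLocPrimitive (fun x => c * f x) (fun x => c * f' x) :=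
  hf.clm_comp (ContinuousLinearMap.mul ℝ ℂ c)

theorem neg {f f' : ℝ → ℂ} (hf : IsLocPrimitive f f') :
    IsLocPrimitive (fun x => -f x) (fun x => -f' x) := by
  simpa using hf.const_mul (-1)

/-- The product rule. -/
theorem mul {f f' g g' : ℝ → ℂ} (hf : IsLocPrimitive f f') (hg : IsLocPrimitive g g') :
    IsLocPrimitive (fun x => f x * g x) (fun x => f' x * g x + f x * g' x) := by
  refine of_ae_hasDerivAt (fun a b => ?_) ?_ ?_
  · exact (hf.absolutelyContinuousOnInterval a b).smul (hg.absolutelyContinuousOnInterval a b)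
  · filter_upwards [hf.ae_hasDerivAt, hg.ae_hasDerivAt] with x h1 h2 using h1.mul h2
  · refine LocallyIntegrable.add ?_ (hg.locallyIntegrable.continuous_mul hf.continuous)
    exact hf.locallyIntegrable.mul_continuous hg.continuous

/-- If a function and its derivative are both integrable on `ℝ`, then the function vanishes at
`±∞`, and so the derivative has integral zero. -/
theorem integral_eq_zero [CompleteSpace E] (h : IsLocPrimitive f f') (hf : Integrable f volume)
    (hf' : Integrable f' volume) : ∫ x, f' x = 0 := by
  have hlim : ∀ {l : Filter ℝ} {c : E}, l = atTop ∨ l = atBot →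
      Tendsto (fun x => ∫ t in (0 : ℝ)..x, f' t) l (𝓝 c) → f 0 + c = 0 := by
    intro l c hl hc
    have hfl : Tendsto f l (𝓝 (f 0 + c)) := by
      rw [show f = fun x => f 0 + ∫ t in (0 : ℝ)..x, f' t from funext h.eq_add_integral]
      simpa using hc.const_add (f 0)
    refine IntegrableAtFilter.eq_zero_of_tendsto (hf.integrableAtFilter l) (fun s hs => ?_) hfl
    rcases hl with rfl | rfl
    · obtain ⟨b, hb⟩ := mem_atTop_sets.1 hs
      rw [← top_le_iff, ← Real.volume_Ici (a := b)]
      exact measure_mono hb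
    · obtain ⟨b, hb⟩ := mem_atBot_sets.1 hs
      rw [← top_le_iff, ← Real.volume_Iic (a := b)]
      exact measure_mono hb
  have htop := hlim (.inl rfl) (intervalIntegral_tendsto_integral_Ioi 0 hf'.integrableOn tendsto_id)
  have hbot := hlim (l := atBot) (c := -∫ t in Set.Iic (0 : ℝ), f' t) (.inr rfl) (by
    simp_rw [intervalIntegral.integral_symm _ (0 : ℝ)]
    exact (intervalIntegral_tendsto_integral_Iic 0 hf'.integrableOn tendsto_id).neg)
  rw [← intervalIntegral.integral_Iic_add_Ioi hf'.integrableOn hf'.integrableOn (b := 0)]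
  rw [← sub_eq_add_neg, sub_eq_zero] at hbot
  rw [← hbot, htop]

end IsLocPrimitive

end Primitive

/-! ### Weak derivatives -/

/-- A compactly supported continuous function with zero integral is the derivative of a compactly
supported `C¹` function. -/
theorem exists_hasCompactSupport_deriv_eq {η : ℝ → ℝ} (hη : Continuous η)
    (hs : HasCompactSupport η) (h0 : ∫ x, η x = 0) :
    ∃ φ : ℝ → ℝ, ContDiff ℝ 1 φ ∧ HasCompactSupport φ ∧ deriv φ = η := by
  obtain ⟨R, hR⟩ := hs.isCompact.isBounded.subset_closedBall 0
  have hout : ∀ x, R < |x| → η x = 0 := fun x hx => by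
    by_contra hne
    have := hR (subset_tsupport _ hne)
    rw [mem_closedBall_zero_iff, Real.norm_eq_abs] at this
    linarith
  have hd : ∀ x, HasDerivAt (fun x => ∫ t in (-R - 1)..x, η t) (η x) x := fun x =>
    intervalIntegral.integral_hasDerivAt_right (hη.intervalIntegrable _ _)
      hη.aestronglyMeasurable.stronglyMeasurableAtFilter hη.continuousAt
  have hde : deriv (fun x => ∫ t in (-R - 1)..x, η t) = η := funext fun x => (hd x).deriv
  refine ⟨fun x => ∫ t in (-R - 1)..x, η t, ?_, ?_, hde⟩
  · rw [contDiff_one_iff_deriv, hde]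
    exact ⟨fun x => (hd x).differentiableAt, hη⟩
  · refine HasCompactSupport.of_support_subset_isCompact (isCompact_Icc (a := -R - 1) (b := R))
      fun x hx => ?_
    by_contra hne
    refine hx ?_
    rw [Set.mem_Icc, not_and_or, not_le, not_le] at hne
    rcases hne with h | h
    · rw [← intervalIntegral.integral_zero (μ := volume) (a := -R - 1) (b := x)]
      refine intervalIntegral.integral_congr fun t ht => hout t ?_
      rw [Set.uIcc_of_ge h.le] at ht
      rw [lt_abs]
      right
      linarith [ht.2]
    · rw [← h0]
      refine intervalIntegral.integral_eq_integral_of_support_subset fun t ht => ?_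
      have : |t| ≤ R := not_lt.1 fun h' => ht (hout t h')
      rw [abs_le] at this
      exact ⟨by linarith [this.1], by linarith [this.2]⟩

/-- The lemma of du Bois-Reymond: a locally integrable function whose distributional derivative is
the locally integrable function `-κ` agrees almost everywhere with a primitive of `-κ`. -/
theorem exists_isLocPrimitive_of_weak_deriv {z κ : ℝ → ℂ} (hz : LocallyIntegrable z volume)
    (hκ : LocallyIntegrable κ volume)
    (h : ∀ φ : ℝ → ℝ, ContDiff ℝ 1 φ → HasCompactSupport φ →
      ∫ x, deriv φ x • z x = ∫ x, φ x • κ x) :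
    ∃ ζ : ℝ → ℂ, IsLocPrimitive ζ (fun x => -κ x) ∧ z =ᵐ[volume] ζ := by
  set P : ℝ → ℂ := fun x => 0 + ∫ t in (0 : ℝ)..x, κ t with hP
  have hPp : IsLocPrimitive P κ := IsLocPrimitive.of_integral hκ 0 0
  have hg : LocallyIntegrable (fun x => z x + P x) volume :=
    hz.add hPp.continuous.locallyIntegrable
  -- integration by parts shows that `z + P` has vanishing distributional derivative
  have hweak : ∀ φ : ℝ → ℝ, ContDiff ℝ 1 φ → HasCompactSupport φ →
      ∫ x, deriv φ x • (z x + P x) = 0 := by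
    intro φ hφ hφs
    have hφ' := hφ.continuous_deriv le_rfl
    have i1 := hz.integrable_smul_left_of_hasCompactSupport hφ' hφs.deriv
    have i2 := hPp.continuous.locallyIntegrable.integrable_smul_left_of_hasCompactSupport
      (μ := volume) hφ' hφs.deriv
    have i3 := hκ.integrable_smul_left_of_hasCompactSupport hφ.continuous hφs
    have i4 := hPp.continuous.locallyIntegrable.integrable_smul_left_of_hasCompactSupport
      (μ := volume) hφ.continuous hφs
    have hpr := ((IsLocPrimitive.of_contDiff hφ).clm_comp Complex.ofRealCLM).mul hPp
    simp only [Complex.ofRealCLM_apply, ← Complex.real_smul] at hpr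
    have h0 := hpr.integral_eq_zero i4 (i2.add i3)
    rw [integral_add i2 i3] at h0
    simp_rw [smul_add]
    rw [integral_add i1 i2, h φ hφ hφs, add_comm]
    exact h0
  obtain ⟨χ, hχc, hχs, hχ1⟩ : ∃ χ : ℝ → ℝ, Continuous χ ∧ HasCompactSupport χ ∧ ∫ x, χ x = 1 := by
    let b : ContDiffBump (0 : ℝ) := default
    exact ⟨b.normed volume, b.continuous_normed, b.hasCompactSupport_normed, b.integral_normed⟩
  have iχ := hg.integrable_smul_left_of_hasCompactSupport hχc hχs
  set c : ℂ := ∫ x, χ x • (z x + P x) with hc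
  have hconst : ∀ᵐ x : ℝ, z x + P x = c := by
    refine ae_eq_of_integral_contDiff_smul_eq hg (locallyIntegrable_const c) fun ψ hψ hψs => ?_
    have iψ := hg.integrable_smul_left_of_hasCompactSupport hψ.continuous hψs
    set m : ℝ := ∫ x, ψ x with hm
    obtain ⟨φ, hφ, hφs, hφd⟩ := exists_hasCompactSupport_deriv_eq (η := fun x => ψ x - m * χ x)
      (hψ.continuous.sub (hχc.const_mul m)) (hψs.sub hχs.mul_left) (by
        rw [integral_sub (hψ.continuous.integrable_of_hasCompactSupport hψs)
          ((hχc.integrable_of_hasCompactSupport hχs).const_mul m), integral_const_mul, hχ1,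
          mul_one, sub_self])
    have h0 := hweak φ hφ hφs
    simp_rw [hφd, sub_smul, mul_smul] at h0
    rw [integral_sub iψ (iχ.fun_smul m), integral_smul, sub_eq_zero] at h0
    rw [h0, integral_smul_const]
  refine ⟨fun x => c + -P x, ?_, hconst.mono fun x hx => ?_⟩
  · have := (IsLocPrimitive.of_integral (u := fun x => -κ x) hκ.neg c 0)
    simpa [hP] using this
  · rw [← hx]
    ring

/-! ### Linear differential equations with locally integrable coefficients -/

/-- The estimate that makes the weight `exp (2 |∫₀ˣ a|)` suitable for a contraction argument. -/
theorem abs_integral_mul_exp_le {a : ℝ → ℝ} (ha : LocallyIntegrable a volume) (ha0 : ∀ x, 0 ≤ a x)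
    (x : ℝ) :
    |∫ t in (0 : ℝ)..x, a t * Real.exp (2 * |∫ s in (0 : ℝ)..t, a s|)|
      ≤ Real.exp (2 * |∫ s in (0 : ℝ)..x, a s|) / 2 := by
  have hQ : IsLocPrimitive (fun t => ∫ s in (0 : ℝ)..t, a s) a := by
    simpa using IsLocPrimitive.of_integral ha 0 0
  have hexp : ∀ c : ℝ, IsLocPrimitive (fun t => Real.exp (c * ∫ s in (0 : ℝ)..t, a s))
      (fun t => c * (a t * Real.exp (c * ∫ s in (0 : ℝ)..t, a s))) := by
    intro c
    have hcont : Continuous fun t => Real.exp (c * ∫ s in (0 : ℝ)..t, a s) :=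
      Real.continuous_exp.comp (hQ.continuous.const_mul c)
    refine IsLocPrimitive.of_ae_hasDerivAt (fun y z => ?_) ?_ ?_
    · exact (hQ.absolutelyContinuousOnInterval y z).contDiff_comp
        (φ := fun y => Real.exp (c * y)) (by fun_prop)
    · filter_upwards [hQ.ae_hasDerivAt] with t ht
      exact (ht.const_mul c).exp.congr_deriv (by ring)
    · exact (ha.mul_continuous hcont).smul c
  rcases le_total 0 x with hx | hx
  · have hQ0 : ∀ t ∈ Set.uIcc 0 x, |∫ s in (0 : ℝ)..t, a s| = ∫ s in (0 : ℝ)..t, a s := by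
      intro t ht
      rw [Set.uIcc_of_le hx] at ht
      exact abs_of_nonneg (intervalIntegral.integral_nonneg ht.1 fun s _ => ha0 s)
    have h1 := (hexp 2).integral_eq 0 x
    rw [intervalIntegral.integral_const_mul, intervalIntegral.integral_same, mul_zero,
      Real.exp_zero] at h1
    rw [intervalIntegral.integral_congr (g := fun t => a t * Real.exp (2 * ∫ s in (0 : ℝ)..t, a s))
      (fun t ht => by simp only [hQ0 t ht]), hQ0 x Set.right_mem_uIcc, abs_of_nonneg]
    · linarith
    · exact intervalIntegral.integral_nonneg hx fun t _ => mul_nonneg (ha0 t) (Real.exp_pos _).le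
  · have hQ0 : ∀ t ∈ Set.uIcc 0 x, 2 * |∫ s in (0 : ℝ)..t, a s| = -2 * ∫ s in (0 : ℝ)..t, a s := by
      intro t ht
      rw [Set.uIcc_of_ge hx] at ht
      rw [abs_of_nonpos]
      · ring
      · rw [intervalIntegral.integral_symm, neg_nonpos]
        exact intervalIntegral.integral_nonneg ht.2 fun s _ => ha0 s
    have h1 := (hexp (-2)).integral_eq 0 x
    rw [intervalIntegral.integral_const_mul, intervalIntegral.integral_same, mul_zero,
      Real.exp_zero] at h1
    rw [intervalIntegral.integral_congr (g := fun t => a t * Real.exp (-2 * ∫ s in (0 : ℝ)..t, a s))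
      (fun t ht => by simp only [hQ0 t ht]), hQ0 x Set.right_mem_uIcc, abs_of_nonpos]
    · linarith
    · rw [intervalIntegral.integral_symm, neg_nonpos]
      exact intervalIntegral.integral_nonneg hx fun t _ => mul_nonneg (ha0 t) (Real.exp_pos _).le

/-- Global solvability of the linear initial value problem `u' = A u`, `u 0 = u₀` with a locally
integrable coefficient `A`. With `W x = exp (2 |∫₀ˣ ‖A‖|)`, the integral equation for `u = W v` is
a fixed point problem for a contraction on bounded continuous functions `v`. -/
theorem exists_isLocPrimitive_linear {E : Type*} [NormedAddCommGroup E] [NormedSpace ℝ E]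
    [CompleteSpace E] {A : ℝ → E →L[ℝ] E} (hA : LocallyIntegrable A volume) (u₀ : E) :
    ∃ u : ℝ → E, u 0 = u₀ ∧ IsLocPrimitive u (fun t => A t (u t)) := by
  have ha : LocallyIntegrable (fun t => ‖A t‖) volume := by
    rw [← locallyIntegrableOn_univ] at hA ⊢
    exact hA.norm
  set W : ℝ → ℝ := fun x => Real.exp (2 * |∫ s in (0 : ℝ)..x, ‖A s‖|) with hW
  have hWpos : ∀ x, 0 < W x := fun x => Real.exp_pos _
  have hWone : ∀ x, 1 ≤ W x := fun x => Real.one_le_exp (by positivity)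
  have hWc : Continuous W := by
    have : Continuous fun x => ∫ s in (0 : ℝ)..x, ‖A s‖ := by
      simpa using (IsLocPrimitive.of_integral ha 0 0).continuous
    fun_prop
  have hloc : ∀ u : ℝ → E, Continuous u → LocallyIntegrable (fun t => A t (u t)) volume := by
    intro u hu
    refine (ha.mul_continuous hu.norm).mono ?_ (.of_forall fun t => ?_)
    · exact (ContinuousLinearMap.id ℝ (E →L[ℝ] E)).aestronglyMeasurable_comp₂
        hA.aestronglyMeasurable hu.aestronglyMeasurable
    · rw [Real.norm_of_nonneg (by positivity)]
      exact (A t).le_opNorm _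
  have hlocW : ∀ v : BoundedContinuousFunction ℝ E,
      LocallyIntegrable (fun t => A t (W t • v t)) volume := fun v =>
    hloc (fun t => W t • v t) (hWc.smul v.continuous)
  have hest : ∀ (v : ℝ → E) (C : ℝ), (∀ x, ‖v x‖ ≤ C) → ∀ x,
      ‖∫ t in (0 : ℝ)..x, A t (W t • v t)‖ ≤ W x / 2 * C := by
    intro v C hv x
    have hC : 0 ≤ C := (norm_nonneg _).trans (hv 0)
    calc ‖∫ t in (0 : ℝ)..x, A t (W t • v t)‖
        ≤ |∫ t in (0 : ℝ)..x, ‖A t‖ * W t * C| := by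
          refine intervalIntegral.norm_integral_le_abs_of_norm_le (.of_forall fun t => ?_)
            (((ha.mul_continuous hWc).mul_continuous continuous_const).intervalIntegrable_real _ _)
          refine ((A t).le_opNorm _).trans ?_
          rw [norm_smul, Real.norm_of_nonneg (hWpos t).le, mul_assoc]
          gcongr
          exact hv t
      _ ≤ W x / 2 * C := by
          rw [intervalIntegral.integral_mul_const, abs_mul, abs_of_nonneg hC]
          gcongr
          exact abs_integral_mul_exp_le ha (fun t => norm_nonneg _) x
  let T : BoundedContinuousFunction ℝ E → BoundedContinuousFunction ℝ E := fun v =>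
    BoundedContinuousFunction.ofNormedAddCommGroup
      (fun x => (W x)⁻¹ • (u₀ + ∫ t in (0 : ℝ)..x, A t (W t • v t)))
      ((hWc.inv₀ fun x => (hWpos x).ne').smul
        (IsLocPrimitive.of_integral (hlocW v) u₀ 0).continuous)
      (‖u₀‖ + ‖v‖ / 2) (fun x => by
        rw [norm_smul, norm_inv, Real.norm_of_nonneg (hWpos x).le, inv_mul_le_iff₀ (hWpos x)]
        refine (norm_add_le _ _).trans ?_
        rw [mul_add]
        refine add_le_add (le_mul_of_one_le_left (norm_nonneg _) (hWone x)) ?_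
        refine (hest v ‖v‖ v.norm_coe_le_norm x).trans_eq ?_
        ring)
  have hT : ContractingWith (1 / 2) T := by
    refine ⟨by rw [← NNReal.coe_lt_coe]; norm_num, LipschitzWith.of_dist_le_mul fun v w => ?_⟩
    refine (BoundedContinuousFunction.dist_le (by positivity)).2 fun x => ?_
    have hsub : T v x - T w x = (W x)⁻¹ • ∫ t in (0 : ℝ)..x, A t (W t • (v t - w t)) := by
      change (W x)⁻¹ • (u₀ + ∫ t in (0 : ℝ)..x, A t (W t • v t))
        - (W x)⁻¹ • (u₀ + ∫ t in (0 : ℝ)..x, A t (W t • w t)) = _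
      rw [← smul_sub, add_sub_add_left_eq_sub, ← intervalIntegral.integral_sub
        ((hlocW v).intervalIntegrable_real _ _)
        ((hlocW w).intervalIntegrable_real _ _)]
      simp only [smul_sub, map_sub]
    rw [dist_eq_norm, hsub, norm_smul, norm_inv, Real.norm_of_nonneg (hWpos x).le,
      inv_mul_le_iff₀ (hWpos x)]
    refine (hest (fun t => v t - w t) (dist v w) (fun t => ?_) x).trans_eq ?_
    · rw [← dist_eq_norm]
      exact BoundedContinuousFunction.dist_coe_le_dist t
    · push_cast
      ring
  obtain ⟨v, hv, -⟩ := hT.exists_fixedPoint 0 (edist_ne_top _ _)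
  have hu : (fun x => W x • v x) = fun x => u₀ + ∫ t in (0 : ℝ)..x, A t (W t • v t) := by
    funext x
    have hx : v x = (W x)⁻¹ • (u₀ + ∫ t in (0 : ℝ)..x, A t (W t • v t)) :=
      (DFunLike.congr_fun hv x).symm
    conv_lhs => rw [hx]
    rw [smul_inv_smul₀ (hWpos x).ne']
  refine ⟨fun x => W x • v x, ?_, ?_⟩
  · refine (congr_fun hu 0).trans ?_
    simp
  · have := IsLocPrimitive.of_integral (hlocW v) u₀ 0
    rwa [← hu] at this

/-! ### The equation `M(q) f = h` for locally absolutely continuous functions -/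

/-- The equation `M(q) f = h` with `f ∈ AC_loc(ℝ)²`, solved for the derivatives of the components:
`f₁' = -i h₁ + q f₂` and `f₂' = i h₂ - conj q f₁`. -/
structure DiracEq (q : ℝ → ℂ) (f h : ℝ → C2) : Prop where
  fst : IsLocPrimitive (fun x => f x 0) (fun x => -Complex.I * h x 0 + q x * f x 1)
  snd : IsLocPrimitive (fun x => f x 1) (fun x => Complex.I * h x 1 - conj (q x) * f x 0)

theorem _root_.MeasureTheory.LocallyIntegrable.coord {h : ℝ → C2}
    (hh : LocallyIntegrable h volume) (i : Fin 2) : LocallyIntegrable (fun x => h x i) volume := by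
  rw [← locallyIntegrableOn_univ] at hh ⊢
  exact (EuclideanSpace.proj i : C2 →L[ℂ] ℂ).locallyIntegrableOn_comp hh

theorem _root_.MeasureTheory.LocallyIntegrable.conj_comp {h : ℝ → ℂ}
    (hh : LocallyIntegrable h volume) : LocallyIntegrable (fun x => conj (h x)) volume := by
  rw [← locallyIntegrableOn_univ] at hh ⊢
  exact (Complex.conjCLE : ℂ →L[ℝ] ℂ).locallyIntegrableOn_comp hh

theorem acLoc_of_coord {f : ℝ → C2}
    (h : ∀ i a b, AbsolutelyContinuousOnInterval (fun x => f x i) a b) : ACLoc f := by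
  have e : f = (fun x => f x 0 • (EuclideanSpace.single 0 1 : C2))
      + fun x => f x 1 • (EuclideanSpace.single 1 1 : C2) := by
    ext x i
    fin_cases i <;> simp
  have hc : ∀ (v : C2) a b, AbsolutelyContinuousOnInterval (fun _ : ℝ => v) a b := fun v a b =>
    (contDiff_const (n := 1)).contDiffOn.absolutelyContinuousOnInterval
  intro a b
  rw [e]
  exact ((h 0 a b).smul (hc _ a b)).add ((h 1 a b).smul (hc _ a b))

theorem ACLoc.coord {f : ℝ → C2} (hf : ACLoc f) (i : Fin 2) (a b : ℝ) :
    AbsolutelyContinuousOnInterval (fun x => f x i) a b :=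
  (hf a b).of_dist_le fun x _ y _ => by
    rw [dist_eq_norm, dist_eq_norm, ← PiLp.sub_apply]
    exact PiLp.norm_apply_le _ i

namespace DiracEq

variable {q : ℝ → ℂ} {f h : ℝ → C2}

theorem acLoc (H : DiracEq q f h) : ACLoc f :=
  acLoc_of_coord (Fin.forall_fin_two.2
    ⟨H.fst.absolutelyContinuousOnInterval, H.snd.absolutelyContinuousOnInterval⟩)

theorem M_ae_eq (H : DiracEq q f h) : M q f =ᵐ[volume] h := by
  filter_upwards [H.fst.ae_hasDerivAt, H.snd.ae_hasDerivAt] with x h0 h1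
  ext i
  fin_cases i
  · simp only [M, h0.deriv]
    simp
    linear_combination (-h x 0) * Complex.I_mul_I
  · simp only [M, h1.deriv]
    simp
    linear_combination (-h x 1) * Complex.I_mul_I

theorem congr (H : DiracEq q f h) {k : ℝ → C2} (hk : h =ᵐ[volume] k) : DiracEq q f k where
  fst := H.fst.congr (hk.mono fun x hx => by simp only [hx])
  snd := H.snd.congr (hk.mono fun x hx => by simp only [hx])

theorem of_acLoc (hq : LocallyIntegrable q volume) (hf : ACLoc f)
    (hM : LocallyIntegrable (M q f) volume) : DiracEq q f (M q f) := by
  have hc : ∀ i, Continuous fun x => f x i := fun i =>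
    (PiLp.continuous_apply 2 _ i).comp hf.continuous
  constructor
  · refine IsLocPrimitive.of_ae_hasDerivAt (hf.coord 0) ?_
      (((hM.coord 0).smul (-Complex.I)).add (hq.mul_continuous (hc 1)))
    filter_upwards [hf.ae_differentiableAt] with x hx
    refine (differentiableAt_coord hx 0).hasDerivAt.congr_deriv ?_
    simp [M]
    linear_combination (deriv (fun t => f t 0) x - q x * f x 1) * Complex.I_mul_I
  · refine IsLocPrimitive.of_ae_hasDerivAt (hf.coord 1) ?_
      (((hM.coord 1).smul Complex.I).sub (hq.conj_comp.mul_continuous (hc 0)))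
    filter_upwards [hf.ae_differentiableAt] with x hx
    refine (differentiableAt_coord hx 1).hasDerivAt.congr_deriv ?_
    simp [M]
    linear_combination (conj (q x) * f x 0 + deriv (fun t => f t 1) x) * Complex.I_mul_I

/-- Cutting off a solution of `M(q) v = 0` by a scalar function `φ`: `M(q) (φ v) = i φ' σ₃ v`. -/
theorem cutoff {v : ℝ → C2} (H : DiracEq q v 0) {φ : ℝ → ℝ} (hφ : ContDiff ℝ 1 φ) :
    DiracEq q (fun x => (φ x : ℂ) • v x)
      (fun x => !₂[Complex.I * ((deriv φ x : ℝ) * v x 0), -Complex.I * ((deriv φ x : ℝ) * v x 1)])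
    where
  fst := by
    refine (((IsLocPrimitive.of_contDiff hφ).clm_comp Complex.ofRealCLM).mul H.fst).congr
      (.of_forall fun x => ?_)
    simp
    linear_combination ((deriv φ x : ℝ) * v x 0 : ℂ) * Complex.I_mul_I
  snd := by
    refine (((IsLocPrimitive.of_contDiff hφ).clm_comp Complex.ofRealCLM).mul H.snd).congr
      (.of_forall fun x => ?_)
    simp
    linear_combination ((deriv φ x : ℝ) * v x 1 : ℂ) * Complex.I_mul_I

/-- The symmetry `(v₁, v₂) ↦ (-conj v₂, conj v₁)` of the equation `M(q) v = 0`. -/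
theorem rotate {v : ℝ → C2} (H : DiracEq q v 0) :
    DiracEq q (fun x => !₂[-conj (v x 1), conj (v x 0)]) 0 where
  fst := by simpa using H.snd.star.neg
  snd := by simpa using H.fst.star

/-- `M(-q) (J f) = J (M(q) f)` for `J = σ₁ C`. -/
theorem sigmaConj_comp (H : DiracEq q f h) :
    DiracEq (-q) (fun x => sigmaConj (f x)) (fun x => sigmaConj (h x)) where
  fst := H.snd.star.congr (.of_forall fun x => by simp [sigmaConj]; ring)
  snd := H.fst.star.congr (.of_forall fun x => by simp [sigmaConj])

/-- The Wronskian-type form `f₁ conj g₁ - f₂ conj g₂` is locally absolutely continuous, with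
derivative the integrand of Green's formula. -/
theorem green {g k : ℝ → C2} (Hf : DiracEq q f h) (Hg : DiracEq (-q) g k) :
    IsLocPrimitive (fun x => f x 0 * conj (g x 0) + -(f x 1 * conj (g x 1)))
      (fun x => -Complex.I * (inner ℂ (g x) (h x) - inner ℂ (k x) (f x))) := by
  refine ((Hf.fst.mul Hg.fst.star).add (Hf.snd.mul Hg.snd.star).neg).congr
    (.of_forall fun x => ?_)
  simp [PiLp.inner_apply, Fin.sum_univ_two]
  ring

end DiracEq

/-- The fundamental solution: since the coefficient matrix `((0, q), (-conj q, 0))` is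
skew-Hermitian, the equation `M(q) u = 0` has a global solution of constant norm one. -/
theorem exists_diracEq_zero {q : ℝ → ℂ} (hq : LocallyIntegrable q volume) :
    ∃ u : ℝ → C2, DiracEq q u 0 ∧ ∀ x, u x 0 * conj (u x 0) + u x 1 * conj (u x 1) = 1 := by
  -- `L₁ v = (v₂, 0)` and `L₂ v = (0, v₁)`, so that the coefficient matrix is `q L₁ - conj q L₂`
  let L₁ : C2 →L[ℂ] C2 := (EuclideanSpace.proj 1 : C2 →L[ℂ] ℂ).smulRight (EuclideanSpace.single 0 1)
  let L₂ : C2 →L[ℂ] C2 := (EuclideanSpace.proj 0 : C2 →L[ℂ] ℂ).smulRight (EuclideanSpace.single 1 1)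
  let Φ : ℂ →L[ℝ] C2 →L[ℝ] C2 :=
    (ContinuousLinearMap.restrictScalarsL ℂ C2 C2 ℝ ℝ).comp
      ((ContinuousLinearMap.id ℝ ℂ).smulRight L₁ - (Complex.conjCLE : ℂ →L[ℝ] ℂ).smulRight L₂)
  have hA : LocallyIntegrable (fun x => Φ (q x)) volume := by
    rw [← locallyIntegrableOn_univ] at hq ⊢
    exact Φ.locallyIntegrableOn_comp hq
  obtain ⟨u, hu0, hu⟩ := exists_isLocPrimitive_linear hA (EuclideanSpace.single 0 1)
  have hΦ0 : ∀ c (v : C2), Φ c v 0 = c * v 1 := fun c v => by simp [Φ, L₁, L₂]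
  have hΦ1 : ∀ c (v : C2), Φ c v 1 = -(conj c * v 0) := fun c v => by simp [Φ, L₁, L₂]
  have h0 : IsLocPrimitive (fun x => u x 0) (fun x => q x * u x 1) := by
    have := hu.clm_comp ((EuclideanSpace.proj 0 : C2 →L[ℂ] ℂ).restrictScalars ℝ)
    simpa [hΦ0] using this
  have h1 : IsLocPrimitive (fun x => u x 1) (fun x => -(conj (q x) * u x 0)) := by
    have := hu.clm_comp ((EuclideanSpace.proj 1 : C2 →L[ℂ] ℂ).restrictScalars ℝ)
    simpa [hΦ1] using this
  refine ⟨u, ⟨by simpa using h0, by simpa using h1⟩, fun x => ?_⟩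
  have hn := ((h0.mul h0.star).add (h1.mul h1.star)).congr (u := fun _ => 0) (.of_forall fun x => by
    simp
    ring)
  have := hn.eq_add_integral x
  simpa [hu0] using this

/-! ### The graphs of the maximal and the minimal operator -/

theorem mem_graph_DMax_iff {q : ℝ → ℂ} (hq : LocallyIntegrable q volume) {F H : L2} :
    (F, H) ∈ (DMax q).graph ↔ ∃ f : ℝ → C2, F =ᵐ[volume] f ∧ DiracEq q f H := by
  rw [LinearPMap.mem_graph_iff]
  constructor
  · rintro ⟨⟨F', f, hf⟩, rfl, rfl⟩
    exact ⟨f, hf.aeEq, (DiracEq.of_acLoc hq hf.acLoc (hf.memLp.locallyIntegrable one_le_two)).congr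
      (DMax_apply _ hf).symm⟩
  · rintro ⟨f, hFf, hf⟩
    have hr : IsMaxRep q F f :=
      ⟨hFf, hf.acLoc, (memLp_congr_ae hf.M_ae_eq).2 (Lp.memLp H)⟩
    exact ⟨⟨F, f, hr⟩, rfl, Lp.ext ((DMax_apply _ hr).trans hf.M_ae_eq)⟩

theorem mem_graph_DMin_iff {q : ℝ → ℂ} {F H : L2} :
    (F, H) ∈ (DMin q).graph ↔ (F, H) ∈ (DMax q).graph ∧ F ∈ compactSupp := by
  simp only [LinearPMap.mem_graph_iff]
  constructor
  · rintro ⟨⟨F', hF'⟩, rfl, rfl⟩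
    exact ⟨⟨⟨F', hF'.2⟩, rfl, (LinearPMap.domRestrict_apply rfl).symm⟩, hF'.1⟩
  · rintro ⟨⟨⟨F', hF'⟩, rfl, rfl⟩, hs⟩
    exact ⟨⟨F', hs, hF'⟩, rfl, LinearPMap.domRestrict_apply rfl⟩

/-- The maximal operators of `q` and `-q` are formally adjoint to each other. No boundary terms
appear, because the boundary form is integrable on `ℝ` together with its derivative. -/
theorem inner_eq_of_mem_graph_DMax {q : ℝ → ℂ} (hq : LocallyIntegrable q volume) {F H G K : L2}
    (hF : (F, H) ∈ (DMax q).graph) (hG : (G, K) ∈ (DMax (-q)).graph) :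
    inner ℂ G H = inner ℂ K F := by
  obtain ⟨f, hFf, hf⟩ := (mem_graph_DMax_iff hq).1 hF
  obtain ⟨g, hGg, hg⟩ := (mem_graph_DMax_iff hq.neg).1 hG
  have hfL : MemLp f 2 volume := (memLp_congr_ae hFf).1 (Lp.memLp F)
  have hgL : MemLp g 2 volume := (memLp_congr_ae hGg).1 (Lp.memLp G)
  have i1 : Integrable (fun x => inner ℂ (g x) (H x)) volume :=
    (L2.integrable_inner G H).congr (hGg.mono fun x hx => by simp only [hx])
  have i2 : Integrable (fun x => inner ℂ (K x) (f x)) volume :=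
    (L2.integrable_inner K F).congr (hFf.mono fun x hx => by simp only [hx])
  have hcoord : ∀ {v : ℝ → C2}, MemLp v 2 volume → ∀ i, MemLp (fun x => v x i) 2 volume :=
    fun hv i => (EuclideanSpace.proj i : C2 →L[ℂ] ℂ).comp_memLp' hv
  have hprod : ∀ i, Integrable (fun x => f x i * conj (g x i)) volume := fun i =>
    (hcoord hfL i).integrable_mul (hcoord hgL i).star
  have h0 := (hf.green hg).integral_eq_zero ((hprod 0).add (hprod 1).neg)
    ((i1.sub i2).const_mul _)
  rw [integral_const_mul, integral_sub i1 i2, mul_eq_zero, sub_eq_zero] at h0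
  have h1 := h0.resolve_left (neg_ne_zero.2 Complex.I_ne_zero)
  rw [L2.inner_def, L2.inner_def]
  refine Eq.trans (integral_congr_ae (hGg.mono fun x hx => ?_)) (h1.trans
    (integral_congr_ae (hFf.mono fun x hx => ?_)))
  · simp only [hx]
  · simp only [hx]

/-- Cut off solutions of `M(q) v = 0` belong to the domain of the minimal operator. -/
theorem exists_mem_graph_DMin_cutoff {q : ℝ → ℂ} (hq : LocallyIntegrable q volume) {v : ℝ → C2}
    (hv : DiracEq q v 0) {φ : ℝ → ℝ} (hφ : ContDiff ℝ 1 φ) (hφs : HasCompactSupport φ) :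
    ∃ F H : L2, (F, H) ∈ (DMin q).graph ∧ (F =ᵐ[volume] fun x => (φ x : ℂ) • v x) ∧
      (H =ᵐ[volume] fun x =>
        !₂[Complex.I * ((deriv φ x : ℝ) * v x 0), -Complex.I * ((deriv φ x : ℝ) * v x 1)]) := by
  have hvc := hv.acLoc.continuous
  have hφ' := hφ.continuous_deriv le_rfl
  have hvi : ∀ i, Continuous fun x => v x i := fun i => (PiLp.continuous_apply 2 _ i).comp hvc
  have hFc : Continuous fun x => (φ x : ℂ) • v x :=
    (Complex.continuous_ofReal.comp hφ.continuous).smul hvc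
  have hFs : HasCompactSupport fun x => (φ x : ℂ) • v x := by
    refine hφs.mono fun x hx => ?_
    contrapose! hx
    rw [Function.notMem_support] at hx ⊢
    simp [hx]
  have hHc : Continuous fun x => (!₂[Complex.I * ((deriv φ x : ℝ) * v x 0),
      -Complex.I * ((deriv φ x : ℝ) * v x 1)] : C2) := by
    refine (PiLp.continuous_toLp 2 _).comp (continuous_pi fun i => ?_)
    fin_cases i
    · exact continuous_const.mul ((Complex.continuous_ofReal.comp hφ').mul (hvi 0))
    · exact continuous_const.mul ((Complex.continuous_ofReal.comp hφ').mul (hvi 1))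
  have hHs : HasCompactSupport fun x => (!₂[Complex.I * ((deriv φ x : ℝ) * v x 0),
      -Complex.I * ((deriv φ x : ℝ) * v x 1)] : C2) := by
    refine hφs.deriv.mono fun x hx => ?_
    contrapose! hx
    rw [Function.notMem_support] at hx ⊢
    ext i
    fin_cases i <;> simp [hx]
  have hFL : MemLp (fun x => (φ x : ℂ) • v x) 2 volume := hFc.memLp_of_hasCompactSupport hFs
  have hHL := hHc.memLp_of_hasCompactSupport (p := 2) (μ := volume) hHs
  refine ⟨hFL.toLp, hHL.toLp, mem_graph_DMin_iff.2 ⟨(mem_graph_DMax_iff hq).2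
    ⟨_, hFL.coeFn_toLp, (hv.cutoff hφ).congr hHL.coeFn_toLp.symm⟩, _, hFs.isCompact, ?_⟩,
    hFL.coeFn_toLp, hHL.coeFn_toLp⟩
  filter_upwards [hFL.coeFn_toLp] with x hx hxs
  rw [hx]
  exact image_eq_zero_of_notMem_tsupport (f := fun x => (φ x : ℂ) • v x) hxs

/-- Testing the adjoint relation `(F, K) = (M(q) F, Y)` with `F = φ v`, where `M(q) v = 0`, shows
that the scalar function `i (conj Y₁ v₁ - conj Y₂ v₂)` has the weak derivative
`-(conj K₁ v₁ + conj K₂ v₂)`. -/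
theorem exists_isLocPrimitive_of_adjoint {q : ℝ → ℂ} (hq : LocallyIntegrable q volume) {Y K : L2}
    (h : ∀ F H : L2, (F, H) ∈ (DMin q).graph → inner ℂ K F = inner ℂ Y H)
    {v : ℝ → C2} (hv : DiracEq q v 0) :
    ∃ ζ : ℝ → ℂ,
      IsLocPrimitive ζ (fun x => -(conj (K x 0) * v x 0 + conj (K x 1) * v x 1)) ∧
      (fun x => Complex.I * (conj (Y x 0) * v x 0 - conj (Y x 1) * v x 1)) =ᵐ[volume] ζ := by
  have hvi : ∀ i, Continuous fun x => v x i := fun i =>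
    (PiLp.continuous_apply 2 _ i).comp hv.acLoc.continuous
  have hL : ∀ Z : L2, ∀ i, LocallyIntegrable (fun x => conj (Z x i) * v x i) volume := fun Z i =>
    (((Lp.memLp Z).locallyIntegrable one_le_two).coord i).conj_comp.mul_continuous (hvi i)
  refine exists_isLocPrimitive_of_weak_deriv (((hL Y 0).sub (hL Y 1)).smul Complex.I)
    ((hL K 0).add (hL K 1)) fun φ hφ hφs => ?_
  obtain ⟨F, H, hFH, hF, hH⟩ := exists_mem_graph_DMin_cutoff hq hv hφ hφs
  have := h F H hFH
  rw [L2.inner_def, L2.inner_def] at this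
  refine Eq.trans ?_ (this.symm.trans ?_)
  · refine integral_congr_ae (hH.mono fun x hx => ?_)
    simp only [hx]
    simp [PiLp.inner_apply, Fin.sum_univ_two]
    ring
  · refine integral_congr_ae (hF.mono fun x hx => ?_)
    simp only [hx]
    simp [PiLp.inner_apply, Fin.sum_univ_two]
    ring

/-- The adjoint of the minimal operator of `q` is contained in the maximal operator of `-q`:
variation of constants with the unitary fundamental matrix `((u₁, -conj u₂), (u₂, conj u₁))`
recovers `Y` from the two scalar primitives of `exists_isLocPrimitive_of_adjoint`. -/
theorem mem_graph_DMax_neg_of_adjoint {q : ℝ → ℂ} (hq : LocallyIntegrable q volume) {Y K : L2}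
    (h : ∀ F H : L2, (F, H) ∈ (DMin q).graph → inner ℂ K F = inner ℂ Y H) :
    (Y, K) ∈ (DMax (-q)).graph := by
  obtain ⟨u, hu, hu1⟩ := exists_diracEq_zero hq
  obtain ⟨ζ, hζ, hζY⟩ := exists_isLocPrimitive_of_adjoint hq h hu
  obtain ⟨ξ, hξ, hξY⟩ := exists_isLocPrimitive_of_adjoint hq h hu.rotate
  refine (mem_graph_DMax_iff hq.neg).2 ⟨fun x =>
    !₂[Complex.I * (conj (ζ x) * u x 0 + -(conj (ξ x) * conj (u x 1))),
      -Complex.I * (conj (ζ x) * u x 1 + conj (ξ x) * conj (u x 0))], ?_, ?_, ?_⟩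
  · filter_upwards [hζY, hξY] with x h1 h2
    rw [← h1, ← h2]
    have hx := hu1 x
    ext i
    fin_cases i
    · simp
      linear_combination (-Y x 0) * hx +
        (Y x 0 * (u x 0 * conj (u x 0) + u x 1 * conj (u x 1))) * Complex.I_mul_I
    · simp
      linear_combination (-Y x 1) * hx +
        (Y x 1 * (u x 0 * conj (u x 0) + u x 1 * conj (u x 1))) * Complex.I_mul_I
  · refine (((hζ.star.mul hu.fst).add (hξ.star.mul hu.snd.star).neg).const_mul
      Complex.I).congr (.of_forall fun x => ?_)
    have hx := hu1 x
    simp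
    linear_combination (-Complex.I * K x 0) * hx
  · refine (((hζ.star.mul hu.snd).add (hξ.star.mul hu.fst.star)).const_mul
      (-Complex.I)).congr (.of_forall fun x => ?_)
    have hx := hu1 x
    simp
    linear_combination (Complex.I * K x 1) * hx

end NLSDirac

/-! ### The adjoint of a graph -/

/-- The double adjoint of a graph is contained in its closure, since both adjoints are orthogonal
complements in the Hilbert space `E × F` up to the isometry `(x, y) ↦ (-y, x)`. -/
theorem Submodule.adjoint_adjoint_le {𝕜 E F : Type*} [RCLike 𝕜]
    [NormedAddCommGroup E] [InnerProductSpace 𝕜 E] [CompleteSpace E]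
    [NormedAddCommGroup F] [InnerProductSpace 𝕜 F] [CompleteSpace F]
    (g : Submodule 𝕜 (E × F)) : g.adjoint.adjoint ≤ g.topologicalClosure := by
  intro x hx
  rw [Submodule.mem_adjoint_iff] at hx
  set p : Submodule 𝕜 (WithLp 2 (E × F)) :=
    g.comap (WithLp.linearEquiv 2 𝕜 (E × F)).toLinearMap with hp
  have hxp : WithLp.toLp 2 x ∈ pᗮᗮ := by
    rw [Submodule.mem_orthogonal]
    intro y hy
    rw [Submodule.mem_orthogonal] at hy
    have hyg : (y.snd, -y.fst) ∈ g.adjoint := by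
      rw [Submodule.mem_adjoint_iff]
      intro a b hab
      have := hy (WithLp.toLp 2 (a, b)) hab
      rw [WithLp.prod_inner_apply] at this
      rw [inner_neg_right, sub_neg_eq_add, add_comm]
      exact this
    have := hx _ _ hyg
    rw [inner_neg_left, sub_eq_zero, neg_eq_iff_add_eq_zero] at this
    rw [WithLp.prod_inner_apply]
    exact this
  rw [Submodule.orthogonal_orthogonal_eq_closure] at hxp
  have hcl : WithLp.toLp 2 x ∈ closure (p : Set (WithLp 2 (E × F))) := hxp
  change x ∈ closure (g : Set (E × F))
  exact map_mem_closure (WithLp.prod_continuous_ofLp 2 E F) hcl fun y hy => hy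

namespace NLSDirac

/-! ### Adjoint and closure of the minimal operator -/

theorem dense_domain_DMin {q : ℝ → ℂ} (hq : LocallyIntegrable q volume) :
    Dense ((DMin q).domain : Set L2) := by
  rw [Submodule.dense_iff_topologicalClosure_eq_top, Submodule.topologicalClosure_eq_top_iff,
    Submodule.eq_bot_iff]
  intro K hK
  -- `K ⊥ dom` says that `(0, K)` satisfies the adjoint relation
  refine (DMax (-q)).graph_fst_eq_zero_snd (mem_graph_DMax_neg_of_adjoint (Y := 0) hq
    fun F H hFH => ?_) rfl
  rw [inner_zero_left]
  exact (Submodule.mem_orthogonal' _ _).1 hK F (LinearPMap.mem_domain_of_mem_graph hFH)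

theorem DMin_le_DMax (q : ℝ → ℂ) : DMin q ≤ DMax q := LinearPMap.domRestrict_le

theorem adjoint_DMin {q : ℝ → ℂ} (hq : LocallyIntegrable q volume) :
    (DMin q).adjoint = DMax (-q) := by
  refine LinearPMap.eq_of_eq_graph ?_
  rw [LinearPMap.adjoint_graph_eq_graph_adjoint (dense_domain_DMin hq)]
  ext ⟨Y, K⟩
  rw [Submodule.mem_adjoint_iff]
  constructor
  · intro h
    refine mem_graph_DMax_neg_of_adjoint hq fun F H hFH => ?_
    rw [← inner_conj_symm K F, ← inner_conj_symm Y H, sub_eq_zero.1 (h F H hFH)]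
  · intro h F H hFH
    rw [sub_eq_zero, ← inner_conj_symm H Y, ← inner_conj_symm F K,
      inner_eq_of_mem_graph_DMax hq (LinearPMap.le_graph_of_le (DMin_le_DMax q) hFH) h]

theorem isClosed_DMax {q : ℝ → ℂ} (hq : LocallyIntegrable q volume) : (DMax q).IsClosed := by
  rw [← neg_neg q, ← adjoint_DMin hq.neg]
  exact LinearPMap.adjoint_isClosed (dense_domain_DMin hq.neg)

theorem isClosable_DMin {q : ℝ → ℂ} (hq : LocallyIntegrable q volume) : (DMin q).IsClosable :=
  (isClosed_DMax hq).isClosable.leIsClosable (DMin_le_DMax q)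

theorem closure_DMin {q : ℝ → ℂ} (hq : LocallyIntegrable q volume) :
    (DMin q).closure = DMax q := by
  refine LinearPMap.eq_of_eq_graph ?_
  rw [← (isClosable_DMin hq).graph_closure_eq_closure_graph]
  refine le_antisymm (Submodule.topologicalClosure_minimal _
    (LinearPMap.le_graph_of_le (DMin_le_DMax q)) (isClosed_DMax hq)) ?_
  refine le_trans (fun ⟨F, H⟩ hF => ?_) (Submodule.adjoint_adjoint_le _)
  rw [← LinearPMap.adjoint_graph_eq_graph_adjoint (dense_domain_DMin hq), adjoint_DMin hq,
    Submodule.mem_adjoint_iff]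
  intro G K hG
  rw [sub_eq_zero, inner_eq_of_mem_graph_DMax hq hF hG]

/-! ### The conjugation -/

theorem Conjugation.mem_graph_sandwich_iff {H : Type*} [NormedAddCommGroup H]
    [InnerProductSpace ℂ H] (J : Conjugation H) (S : H →ₗ.[ℂ] H) {u w : H} :
    (u, w) ∈ (J.sandwich S).graph ↔ (J.map u, J.map w) ∈ S.graph := by
  simp only [LinearPMap.mem_graph_iff]
  constructor
  · rintro ⟨⟨u', hu⟩, rfl, rfl⟩
    exact ⟨⟨J.map u', hu⟩, rfl, (J.involutive _).symm⟩
  · rintro ⟨⟨u', hu⟩, rfl, hw⟩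
    refine ⟨⟨u, hu⟩, rfl, ?_⟩
    change J.map (S _) = w
    rw [hw, J.involutive]

theorem J_map_mem_graph_DMax {q : ℝ → ℂ} (hq : LocallyIntegrable q volume) {F H : L2}
    (h : (F, H) ∈ (DMax q).graph) : (J.map F, J.map H) ∈ (DMax (-q)).graph := by
  obtain ⟨f, hFf, hf⟩ := (mem_graph_DMax_iff hq).1 h
  have hJ : ∀ G : L2, (J.map G : L2) =ᵐ[volume] fun x => sigmaConj (G x) := fun G =>
    sigmaConj.coeFn_compLpL (p := 2) (μ := volume) G
  exact (mem_graph_DMax_iff hq.neg).2 ⟨_, (hJ F).trans (hFf.mono fun x hx => by simp only [hx]),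
    hf.sigmaConj_comp.congr (hJ H).symm⟩

theorem sandwich_DMax_neg {q : ℝ → ℂ} (hq : LocallyIntegrable q volume) :
    J.sandwich (DMax (-q)) = DMax q := by
  refine LinearPMap.eq_of_eq_graph ?_
  ext ⟨F, H⟩
  rw [Conjugation.mem_graph_sandwich_iff]
  refine ⟨fun h => ?_, J_map_mem_graph_DMax hq⟩
  have := J_map_mem_graph_DMax hq.neg h
  rwa [J.involutive, J.involutive, neg_neg] at this

theorem adjoint_DMax {q : ℝ → ℂ} (hq : LocallyIntegrable q volume) :
    (DMax q).adjoint = DMax (-q) := by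
  have hd : Dense ((DMax q).domain : Set L2) := (dense_domain_DMin hq).mono (DMin_le_DMax q).1
  refine LinearPMap.eq_of_eq_graph (le_antisymm ?_ ?_)
  · rw [← adjoint_DMin hq, LinearPMap.adjoint_graph_eq_graph_adjoint hd,
      LinearPMap.adjoint_graph_eq_graph_adjoint (dense_domain_DMin hq)]
    intro x hx
    rw [Submodule.mem_adjoint_iff] at hx ⊢
    exact fun F H h => hx F H (LinearPMap.le_graph_of_le (DMin_le_DMax q) h)
  · rw [LinearPMap.adjoint_graph_eq_graph_adjoint hd]
    rintro ⟨G, K⟩ hG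
    rw [Submodule.mem_adjoint_iff]
    intro F H hF
    rw [sub_eq_zero, ← inner_conj_symm H G, ← inner_conj_symm F K,
      inner_eq_of_mem_graph_DMax hq hF hG]

theorem isJSelfAdjoint_DMax {q : ℝ → ℂ} (hq : LocallyIntegrable q volume) :
    IsJSelfAdjoint J (DMax q) :=
  ⟨(dense_domain_DMin hq).mono (DMin_le_DMax q).1, by rw [adjoint_DMax hq, sandwich_DMax_neg hq]⟩

end NLSDirac

theorem theorem3p2 (q : ℝ → ℂ) (hq : MeasureTheory.LocallyIntegrable q MeasureTheory.volume) :
    NLSDirac.IsEssentiallyJSelfAdjoint NLSDirac.J (NLSDirac.DMin q) ∧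
    (NLSDirac.DMin q).closure = NLSDirac.J.sandwich (NLSDirac.DMin q).adjoint ∧
    (NLSDirac.DMin q).closure = NLSDirac.DMax q ∧
    NLSDirac.IsJSelfAdjoint NLSDirac.J (NLSDirac.DMax q) := by
  have hmax := NLSDirac.isJSelfAdjoint_DMax hq
  have hcl := NLSDirac.closure_DMin hq
  refine ⟨⟨NLSDirac.dense_domain_DMin hq, NLSDirac.isClosable_DMin hq, ?_⟩, ?_, hcl, hmax⟩
  · rwa [hcl]
  · rw [hcl, NLSDirac.adjoint_DMin hq, NLSDirac.sandwich_DMax_neg hq]
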